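/- Let $\mathcal D_{\mathbb R}=\{[m2^k,(m+1)2^k): k,m\in\mathbb Z\}$ be the family of dyadic intervals of $\mathbb R$, write $\langle f\rangle_I=\frac1{|I|}\int_I f\,dt$, and for a nonnegative locally integrable function $w$ on $\mathbb R$ let $$(Mw)(t)=\sup_{I\in\mathcal D_{\mathbb R},\ t\in I}\langle w\rangle_I\in[0,\infty]$$ be its dyadic maximal function. For $J\in\mathcal D_{\mathbb R}$ and real numbers $x_1,x_2,L$ with $0<x_1\le L$ and $x_1^2\le x_2$, put $$\mathbf B(x_1,x_2;L)=\sup\Big\{\langle (Mw)^2\rangle_J:\ w\ge 0 \text{ locally integrable on } \mathbb R,\ \langle w\rangle_J=x_1,\ \langle w^2\rangle_J=x_2,\ \sup_{I\supseteq J,\ I\in\mathcal D_{\mathbb R}}\langle w\rangle_I=L\Big\}.$$ **Theorem.** For every dyadic interval $J$ and all $x_1,x_2,L$ as above, $$\mathbf B(x_1,x_2;L)=\begin{cases}4(x_2-x_1^2)+L^2, & 0<x_1\le \frac L2,\\[4pt] \big(\sqrt{x_2}+\sqrt{x_2-L(2x_1-L)}\,\big)^2, & \frac L2\le x_1\le L.\end{cases}$$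 In particular $\mathbf B$ does not depend on $J$. -/

import Mathlib

open MeasureTheory Set
open scoped ENNReal

noncomputable section

/-- The family of all dyadic intervals `[m 2^k, (m+1) 2^k)` of the real line, `k, m` integers. -/
def dyadicIntervals : Set (Set ℝ) :=
  {I | ∃ k m : ℤ, I = Ico ((m : ℝ) * (2 : ℝ) ^ k) (((m : ℝ) + 1) * (2 : ℝ) ^ k)}

/-- The dyadic maximal function `(M w)(t)`: the supremum, in `[0, ∞]`, of the averages of the
nonnegative locally integrable function `w` over the dyadic intervals that contain `t`. -/
def dyadicMaximal (w : ℝ → ℝ) (t : ℝ) : ℝ≥0∞ :=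
  ⨆ I ∈ dyadicIntervals, ⨆ _ : t ∈ I, ENNReal.ofReal (⨍ s in I, w s)

/-- `w` is a test function for the interval `J` and the point `(x₁, x₂; L)`: it is nonnegative and
locally integrable on the line, its average over `J` is `x₁`, its square is integrable on `J` with
average `x₂`, and the supremum of its averages over the dyadic intervals containing `J` is `L`. -/
structure IsTestFunction (J : Set ℝ) (x₁ x₂ L : ℝ) (w : ℝ → ℝ) : Prop where
  nonneg : ∀ t, 0 ≤ w t
  locallyIntegrable : LocallyIntegrable w volume
  average_eq : ⨍ t in J, w t = x₁
  sq_integrableOn : IntegrableOn (fun t => w t ^ 2) J volume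
  average_sq_eq : ⨍ t in J, w t ^ 2 = x₂
  isLUB_ancestors : IsLUB {a : ℝ | ∃ I ∈ dyadicIntervals, J ⊆ I ∧ a = ⨍ t in I, w t} L

/-- The Bellman function: the supremum, in `[0, ∞]`, of the averages over `J` of `(M w)²`, taken
over all test functions `w` for the interval `J` and the point `(x₁, x₂; L)`. -/
def maximalBellman (J : Set ℝ) (x₁ x₂ L : ℝ) : ℝ≥0∞ :=
  ⨆ (w : ℝ → ℝ) (_ : IsTestFunction J x₁ x₂ L w), (∫⁻ t in J, dyadicMaximal w t ^ 2) / volume J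

end

/-! Upper bound. Let `G` be the maximal function truncated at a finite depth below `J`, started from
the value `L`. Descending one generation, the running maximum changes from `L` to an average `a`
only if `a > L`, and `a² - 2a·a ≤ L² - 2L·a` because `(L - a)² ≥ 0`. Hence `⟨G² - 2Gw⟩ ≤ L² - 2L x₁`
(`integral_truncatedMaximal_sq_le`). Equivalently `‖G - w‖² ≤ x₂ - L(2x₁ - L)` in normalized
`L²(J)`, and the triangle inequality `‖G‖ ≤ ‖w‖ + ‖G - w‖` gives the second formula. If `x₁ ≤ L/2`,
integrating `(2(w - x₁) - (G - L))² ≥ 0` and using `(G - L)(L - 2x₁) ≥ 0` gives the first. Monotone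
convergence removes the truncation.

Lower bound. Gluing functions on the two halves makes attainability stable under midpoints for fixed
`L`, hence under mixing in dyadic proportions. On the line `x₁ = L`, a self-similar construction,
with `Mw` nearly a constant multiple of `w`, comes arbitrarily close to `(√x₂ + √(x₂ - L²))²`
(`isAttainable_of_average_eq_max`). For `x₁ < L`, such a function on a proportion `α` is mixed with
a constant on the rest. The best `α` is read off from equality in the triangle inequality; it
decreases to `0` at `x₁ = L/2`, and below that the limit `α → 0+` is taken. Finally the sibling of
`J` is filled so that the parent of `J` has average exactly `L`. -/

/-- The dyadic interval `[m 2^k, (m+1) 2^k)`. -/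
def dyadicCell (k m : ℤ) : Set ℝ :=
  Ico ((m : ℝ) * (2 : ℝ) ^ k) (((m : ℝ) + 1) * (2 : ℝ) ^ k)

theorem dyadicCell_mem (k m : ℤ) : dyadicCell k m ∈ dyadicIntervals := ⟨k, m, rfl⟩

theorem measurableSet_dyadicCell (k m : ℤ) : MeasurableSet (dyadicCell k m) := measurableSet_Ico

theorem measureReal_dyadicCell (k m : ℤ) : volume.real (dyadicCell k m) = (2 : ℝ) ^ k := by
  have h : (0 : ℝ) < 2 ^ k := by positivity
  rw [dyadicCell, Real.volume_real_Ico_of_le (by nlinarith)]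
  ring

theorem volume_dyadicCell (k m : ℤ) : volume (dyadicCell k m) = ENNReal.ofReal ((2 : ℝ) ^ k) := by
  rw [dyadicCell, Real.volume_Ico]
  congr 1
  ring

theorem volume_dyadicCell_ne_top (k m : ℤ) : volume (dyadicCell k m) ≠ ∞ := by
  simp [volume_dyadicCell]

theorem volume_dyadicCell_ne_zero (k m : ℤ) : volume (dyadicCell k m) ≠ 0 := by
  rw [volume_dyadicCell, Ne, ENNReal.ofReal_eq_zero, not_le]
  positivity

theorem mem_dyadicCell_iff {k m : ℤ} {t : ℝ} : t ∈ dyadicCell k m ↔ ⌊t / (2 : ℝ) ^ k⌋ = m := by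
  have h : (0 : ℝ) < 2 ^ k := by positivity
  rw [Int.floor_eq_iff, dyadicCell, mem_Ico, le_div_iff₀ h, div_lt_iff₀ h]

theorem setAverage_dyadicCell (w : ℝ → ℝ) (k m : ℤ) :
    ⨍ t in dyadicCell k m, w t = (∫ t in dyadicCell k m, w t) / 2 ^ k := by
  rw [setAverage_eq, measureReal_dyadicCell, smul_eq_mul, div_eq_inv_mul]

theorem dyadicCell_eq_union (k m : ℤ) :
    dyadicCell k m = dyadicCell (k - 1) (2 * m) ∪ dyadicCell (k - 1) (2 * m + 1) := by
  have h : (2 : ℝ) ^ k = 2 * 2 ^ (k - 1) := by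
    rw [zpow_sub_one₀ (by norm_num)]; ring
  have h0 : (0 : ℝ) < 2 ^ (k - 1) := by positivity
  unfold dyadicCell
  rw [h]
  push_cast
  rw [show (2 * (m : ℝ) + 1) * 2 ^ (k - 1) = (m : ℝ) * (2 * 2 ^ (k - 1)) + 2 ^ (k - 1) by ring,
    Ico_union_Ico' (by linarith) (by linarith), min_eq_left (by linarith),
    max_eq_right (by linarith)]
  congr 1 <;> ring

theorem disjoint_dyadicCell {k m n : ℤ} (h : m ≠ n) :
    Disjoint (dyadicCell k m) (dyadicCell k n) := by
  rw [Set.disjoint_left]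
  intro t h1 h2
  rw [mem_dyadicCell_iff] at h1 h2
  exact h (h1.symm.trans h2)

theorem disjoint_halves (k m : ℤ) :
    Disjoint (dyadicCell (k - 1) (2 * m)) (dyadicCell (k - 1) (2 * m + 1)) :=
  disjoint_dyadicCell (by omega)

theorem two_zpow_eq (k : ℤ) : (2 : ℝ) ^ k = 2 * 2 ^ (k - 1) := by
  rw [zpow_sub_one₀ (by norm_num)]; ring

theorem setIntegral_dyadicCell_eq_add {f : ℝ → ℝ} {k m : ℤ}
    (hf : IntegrableOn f (dyadicCell k m)) :
    ∫ t in dyadicCell k m, f t = (∫ t in dyadicCell (k - 1) (2 * m), f t) +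
      ∫ t in dyadicCell (k - 1) (2 * m + 1), f t := by
  rw [dyadicCell_eq_union] at hf ⊢
  exact setIntegral_union (disjoint_halves k m) (measurableSet_dyadicCell _ _)
    hf.left_of_union hf.right_of_union

/-- Of two dyadic intervals with a common point, the longer contains the shorter. -/
theorem dyadicCell_subset {k j m n : ℤ} (hkj : k ≤ j) {t : ℝ} (h1 : t ∈ dyadicCell k m)
    (h2 : t ∈ dyadicCell j n) : dyadicCell k m ⊆ dyadicCell j n := by
  obtain ⟨d, rfl⟩ := Int.le.dest hkj
  clear hkj
  induction d generalizing n with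
  | zero =>
    rw [mem_dyadicCell_iff] at h1 h2
    simp only [Nat.cast_zero, add_zero] at h2 ⊢
    rw [← h1, ← h2]
  | succ d ih =>
    have hs := dyadicCell_eq_union (k + ((d + 1 : ℕ) : ℤ)) n
    rw [show k + ((d + 1 : ℕ) : ℤ) - 1 = k + d by push_cast; ring] at hs
    rw [hs] at h2 ⊢
    rcases h2 with h2 | h2
    · exact (ih h2).trans subset_union_left
    · exact (ih h2).trans subset_union_right

/-! ### The truncated maximal function -/

/-- The average of `w` over the dyadic interval of length `2^k` that contains `t`. -/
noncomputable def cellAverage (w : ℝ → ℝ) (k : ℤ) (t : ℝ) : ℝ :=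
  ⨍ s in dyadicCell k ⌊t / (2 : ℝ) ^ k⌋, w s

theorem cellAverage_of_mem (w : ℝ → ℝ) {k m : ℤ} {t : ℝ} (h : t ∈ dyadicCell k m) :
    cellAverage w k t = ⨍ s in dyadicCell k m, w s := by
  rw [cellAverage, mem_dyadicCell_iff.1 h]

theorem measurable_cellAverage (w : ℝ → ℝ) (k : ℤ) : Measurable (cellAverage w k) := by
  have h : Measurable fun m : ℤ => ⨍ s in dyadicCell k m, w s := measurable_from_top
  exact h.comp (Int.measurable_floor.comp (measurable_id.div_const _))

/-- The maximum of `L` and the averages of `w` over the dyadic intervals of length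
`2^(k-1), …, 2^(k-n)` that contain `t`. -/
noncomputable def truncatedMaximal (w : ℝ → ℝ) : ℕ → ℤ → ℝ → ℝ → ℝ
  | 0, _, L, _ => L
  | n + 1, k, L, t => truncatedMaximal w n (k - 1) (max L (cellAverage w (k - 1) t)) t

theorem le_truncatedMaximal (w : ℝ → ℝ) (n : ℕ) (k : ℤ) (L t : ℝ) :
    L ≤ truncatedMaximal w n k L t := by
  induction n generalizing k L with
  | zero => exact le_rfl
  | succ n ih => exact (le_max_left _ _).trans (ih _ _)

theorem truncatedMaximal_le_succ (w : ℝ → ℝ) (n : ℕ) (k : ℤ) (L t : ℝ) :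
    truncatedMaximal w n k L t ≤ truncatedMaximal w (n + 1) k L t := by
  induction n generalizing k L with
  | zero => exact le_truncatedMaximal w 1 k L t
  | succ n ih => exact ih _ _

theorem cellAverage_le_truncatedMaximal (w : ℝ → ℝ) (n : ℕ) (k : ℤ) (L t : ℝ) :
    cellAverage w (k - 1 - n) t ≤ truncatedMaximal w (n + 1) k L t := by
  induction n generalizing k L with
  | zero => simp [truncatedMaximal]
  | succ n ih =>
    refine le_trans (le_of_eq ?_) (ih (k - 1) (max L (cellAverage w (k - 1) t)))
    congr 1
    push_cast
    ring

theorem measurable_truncatedMaximal (w : ℝ → ℝ) (n : ℕ) (k : ℤ) {g : ℝ → ℝ} (hg : Measurable g) :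
    Measurable fun t => truncatedMaximal w n k (g t) t := by
  induction n generalizing k g with
  | zero => exact hg
  | succ n ih => exact ih (k - 1) (hg.max (measurable_cellAverage w (k - 1)))

/-- On a child the first average is a constant and is absorbed into the starting value; this drives
the inductions over the two halves. -/
theorem truncatedMaximal_succ_eqOn (w : ℝ → ℝ) (n : ℕ) (k m : ℤ) (L : ℝ) :
    EqOn (truncatedMaximal w (n + 1) k L)
      (truncatedMaximal w n (k - 1) (max L (⨍ s in dyadicCell (k - 1) m, w s)))
      (dyadicCell (k - 1) m) := by
  intro t ht
  rw [truncatedMaximal, cellAverage_of_mem w ht]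

theorem exists_truncatedMaximal_le (w : ℝ → ℝ) (n : ℕ) (k m : ℤ) (L : ℝ) :
    ∃ C, ∀ t ∈ dyadicCell k m, truncatedMaximal w n k L t ≤ C := by
  induction n generalizing k m L with
  | zero => exact ⟨L, fun _ _ => le_rfl⟩
  | succ n ih =>
    obtain ⟨C, hC⟩ := ih (k - 1) (2 * m) (max L (⨍ s in dyadicCell (k - 1) (2 * m), w s))
    obtain ⟨D, hD⟩ := ih (k - 1) (2 * m + 1) (max L (⨍ s in dyadicCell (k - 1) (2 * m + 1), w s))
    refine ⟨max C D, fun t ht => ?_⟩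
    rw [dyadicCell_eq_union] at ht
    rcases ht with ht | ht
    · rw [truncatedMaximal_succ_eqOn w n k _ L ht]
      exact (hC t ht).trans (le_max_left _ _)
    · rw [truncatedMaximal_succ_eqOn w n k _ L ht]
      exact (hD t ht).trans (le_max_right _ _)

theorem exists_norm_truncatedMaximal_le (w : ℝ → ℝ) (n : ℕ) (k m : ℤ) (L : ℝ) :
    ∃ C, ∀ᵐ t ∂volume.restrict (dyadicCell k m), ‖truncatedMaximal w n k L t‖ ≤ C := by
  obtain ⟨C, hC⟩ := exists_truncatedMaximal_le w n k m L
  refine ⟨max C (-L), ?_⟩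
  filter_upwards [ae_restrict_mem (measurableSet_dyadicCell k m)] with t ht
  rw [Real.norm_eq_abs, abs_le, neg_le, neg_le]
  have h := le_truncatedMaximal w n k L t
  exact ⟨by linarith [le_max_right C (-L)], (hC t ht).trans (le_max_left _ _)⟩

theorem aestronglyMeasurable_truncatedMaximal (w : ℝ → ℝ) (n : ℕ) (k : ℤ) (L : ℝ) (s : Set ℝ) :
    AEStronglyMeasurable (truncatedMaximal w n k L) (volume.restrict s) :=
  (measurable_truncatedMaximal w n k measurable_const).aestronglyMeasurable

theorem integrableOn_mul_truncatedMaximal {w f : ℝ → ℝ} (n : ℕ) {k m : ℤ} (L : ℝ)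
    (hf : IntegrableOn f (dyadicCell k m)) :
    IntegrableOn (fun t => truncatedMaximal w n k L t * f t) (dyadicCell k m) := by
  obtain ⟨C, hC⟩ := exists_norm_truncatedMaximal_le w n k m L
  exact Integrable.bdd_mul hf (aestronglyMeasurable_truncatedMaximal w n k L _) hC

theorem integrableOn_const_dyadicCell (c : ℝ) (k m : ℤ) :
    IntegrableOn (fun _ => c) (dyadicCell k m) :=
  integrableOn_const (volume_dyadicCell_ne_top k m)

theorem integrableOn_truncatedMaximal (w : ℝ → ℝ) (n : ℕ) (k m : ℤ) (L : ℝ) :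
    IntegrableOn (truncatedMaximal w n k L) (dyadicCell k m) := by
  simpa using integrableOn_mul_truncatedMaximal (w := w) n L (integrableOn_const_dyadicCell 1 k m)

theorem integrableOn_truncatedMaximal_sq (w : ℝ → ℝ) (n : ℕ) (k m : ℤ) (L : ℝ) :
    IntegrableOn (fun t => truncatedMaximal w n k L t ^ 2) (dyadicCell k m) := by
  simpa [sq] using integrableOn_mul_truncatedMaximal n L (integrableOn_truncatedMaximal w n k m L)

theorem setIntegral_const_dyadicCell (c : ℝ) (k m : ℤ) :
    ∫ _ in dyadicCell k m, c = c * 2 ^ k := by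
  rw [setIntegral_const, measureReal_dyadicCell, smul_eq_mul, mul_comm]

theorem integrableOn_linearCombination {k m : ℤ} {f g h : ℝ → ℝ}
    (hf : IntegrableOn f (dyadicCell k m)) (hg : IntegrableOn g (dyadicCell k m))
    (hh : IntegrableOn h (dyadicCell k m)) (a b c d : ℝ) :
    IntegrableOn (fun t => a * f t + b * g t + c * h t + d) (dyadicCell k m) :=
  (((hf.const_mul a).add (hg.const_mul b)).add (hh.const_mul c)).add
    (integrableOn_const_dyadicCell d k m)

theorem integral_linearCombination {k m : ℤ} {f g h : ℝ → ℝ}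
    (hf : IntegrableOn f (dyadicCell k m)) (hg : IntegrableOn g (dyadicCell k m))
    (hh : IntegrableOn h (dyadicCell k m)) (a b c d : ℝ) :
    ∫ t in dyadicCell k m, (a * f t + b * g t + c * h t + d) =
      a * (∫ t in dyadicCell k m, f t) + b * (∫ t in dyadicCell k m, g t) +
        c * (∫ t in dyadicCell k m, h t) + d * 2 ^ k := by
  have h1 := (hf.const_mul a).add (hg.const_mul b)
  have h2 := h1.add (hh.const_mul c)
  have e1 := integral_add h2 (integrableOn_const_dyadicCell d k m)
  have e2 := integral_add h1 (hh.const_mul c)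
  have e3 := integral_add (hf.const_mul a) (hg.const_mul b)
  simp only [Pi.add_apply] at e1 e2 e3
  rw [e1, e2, e3, integral_const_mul, integral_const_mul, integral_const_mul,
    setIntegral_const_dyadicCell]

/-! ### The quadratic inequality and the removal of the truncation -/

theorem integral_truncatedMaximal_sq_le {w : ℝ → ℝ} (n : ℕ) (k m : ℤ) (L : ℝ)
    (hw : IntegrableOn w (dyadicCell k m)) :
    ∫ t in dyadicCell k m, truncatedMaximal w n k L t ^ 2 ≤
      L ^ 2 * 2 ^ k + 2 * ((∫ t in dyadicCell k m, truncatedMaximal w n k L t * w t) -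
        L * ∫ t in dyadicCell k m, w t) := by
  induction n generalizing k m L with
  | zero =>
    simp only [truncatedMaximal]
    rw [setIntegral_const_dyadicCell, integral_const_mul]
    linarith
  | succ n ih =>
    have half : ∀ p : ℤ, IntegrableOn w (dyadicCell (k - 1) p) →
        ∫ t in dyadicCell (k - 1) p, truncatedMaximal w (n + 1) k L t ^ 2 ≤
        L ^ 2 * 2 ^ (k - 1) +
          2 * ((∫ t in dyadicCell (k - 1) p, truncatedMaximal w (n + 1) k L t * w t) -
          L * ∫ t in dyadicCell (k - 1) p, w t) := by
      intro p hp
      have e := truncatedMaximal_succ_eqOn w n k p L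
      set a := ⨍ s in dyadicCell (k - 1) p, w s with ha
      have hpos : (0 : ℝ) < 2 ^ (k - 1) := by positivity
      have ha' : ∫ t in dyadicCell (k - 1) p, w t = a * 2 ^ (k - 1) := by
        rw [ha, setAverage_dyadicCell]
        field_simp
      have e1 : ∫ t in dyadicCell (k - 1) p, truncatedMaximal w (n + 1) k L t ^ 2 =
          ∫ t in dyadicCell (k - 1) p, truncatedMaximal w n (k - 1) (max L a) t ^ 2 :=
        setIntegral_congr_fun (measurableSet_dyadicCell _ _) fun t ht => by simp only [e ht]
      have e2 : ∫ t in dyadicCell (k - 1) p, truncatedMaximal w (n + 1) k L t * w t =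
          ∫ t in dyadicCell (k - 1) p, truncatedMaximal w n (k - 1) (max L a) t * w t :=
        setIntegral_congr_fun (measurableSet_dyadicCell _ _) fun t ht => by simp only [e ht]
      rw [e1, e2]
      have := ih (k - 1) p (max L a) hp
      rw [ha'] at this ⊢
      -- When the maximum jumps to `a`, the difference of the two sides is `(L - a)²`.
      have key : max L a ^ 2 - 2 * (max L a * a) ≤ L ^ 2 - 2 * (L * a) := by
        rcases max_cases L a with ⟨h, _⟩ | ⟨h, _⟩ <;> rw [h]
        nlinarith [sq_nonneg (L - a)]
      nlinarith [mul_le_mul_of_nonneg_right key hpos.le]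
    have hw' := hw
    rw [dyadicCell_eq_union] at hw'
    have h1 := half _ hw'.left_of_union
    have h2 := half _ hw'.right_of_union
    rw [setIntegral_dyadicCell_eq_add (integrableOn_truncatedMaximal_sq w (n + 1) k m L),
      setIntegral_dyadicCell_eq_add (integrableOn_mul_truncatedMaximal (n + 1) L hw),
      setIntegral_dyadicCell_eq_add hw, two_zpow_eq k]
    linarith

/-- Intervals containing the cell are controlled by the starting value `L`; shorter ones are met at
a finite depth. -/
theorem dyadicMaximal_le_iSup {w : ℝ → ℝ} {k m : ℤ} {L : ℝ}
    (hL : ∀ I ∈ dyadicIntervals, dyadicCell k m ⊆ I → ⨍ t in I, w t ≤ L)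
    {t : ℝ} (ht : t ∈ dyadicCell k m) :
    dyadicMaximal w t ≤ ⨆ n, ENNReal.ofReal (truncatedMaximal w n k L t) := by
  unfold dyadicMaximal
  refine iSup₂_le fun I hI => iSup_le fun htI => ?_
  obtain ⟨j, p, rfl⟩ := id hI
  change t ∈ dyadicCell j p at htI
  rcases le_or_gt k j with hkj | hkj
  · refine le_iSup_of_le 0 (ENNReal.ofReal_le_ofReal ?_)
    exact hL _ hI (dyadicCell_subset hkj ht htI)
  · obtain ⟨n, hn⟩ := Int.le.dest (show j ≤ k - 1 by omega)
    refine le_iSup_of_le (n + 1) (ENNReal.ofReal_le_ofReal ?_)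
    have := cellAverage_le_truncatedMaximal w n k L t
    rwa [show k - 1 - n = j by omega, cellAverage_of_mem w htI] at this

theorem lintegral_dyadicMaximal_sq_le {w : ℝ → ℝ} {k m : ℤ} {L V : ℝ} (hL0 : 0 ≤ L)
    (hL : ∀ I ∈ dyadicIntervals, dyadicCell k m ⊆ I → ⨍ t in I, w t ≤ L)
    (hV : ∀ n, ∫ t in dyadicCell k m, truncatedMaximal w n k L t ^ 2 ≤ V * 2 ^ k) :
    (∫⁻ t in dyadicCell k m, dyadicMaximal w t ^ 2) / volume (dyadicCell k m) ≤
      ENNReal.ofReal V := by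
  have hpos : (0 : ℝ) < 2 ^ k := by positivity
  have hG : ∀ n t, 0 ≤ truncatedMaximal w n k L t := fun n t =>
    hL0.trans (le_truncatedMaximal w n k L t)
  rw [ENNReal.div_le_iff (volume_dyadicCell_ne_zero k m) (volume_dyadicCell_ne_top k m),
    volume_dyadicCell, ← ENNReal.ofReal_mul' hpos.le]
  calc ∫⁻ t in dyadicCell k m, dyadicMaximal w t ^ 2
      ≤ ∫⁻ t in dyadicCell k m, ⨆ n, ENNReal.ofReal (truncatedMaximal w n k L t ^ 2) := by
        refine setLIntegral_mono' (measurableSet_dyadicCell k m) fun t ht => ?_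
        refine (pow_le_pow_left' (dyadicMaximal_le_iSup hL ht) 2).trans (le_of_eq ?_)
        rw [ENNReal.iSup_pow]
        exact iSup_congr fun n => (ENNReal.ofReal_pow (hG n t) 2).symm
    _ = ⨆ n, ∫⁻ t in dyadicCell k m, ENNReal.ofReal (truncatedMaximal w n k L t ^ 2) := by
        refine lintegral_iSup (fun n => ?_) (monotone_nat_of_le_succ fun n t => ?_)
        · exact ((measurable_truncatedMaximal w n k measurable_const).pow_const 2).ennreal_ofReal
        · exact ENNReal.ofReal_le_ofReal
            (pow_le_pow_left₀ (hG n t) (truncatedMaximal_le_succ w n k L t) 2)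
    _ ≤ ENNReal.ofReal (V * 2 ^ k) := by
        refine iSup_le fun n => ?_
        rw [← ofReal_integral_eq_lintegral_ofReal (integrableOn_truncatedMaximal_sq w n k m L)
          (Filter.Eventually.of_forall fun t => sq_nonneg _)]
        exact ENNReal.ofReal_le_ofReal (hV n)

/-! ### Upper bounds for the Bellman function -/

section UpperBound

variable {k m : ℤ} {x₁ x₂ L : ℝ} {w : ℝ → ℝ}

theorem IsTestFunction.integrableOn (hw : IsTestFunction (dyadicCell k m) x₁ x₂ L w) :
    IntegrableOn w (dyadicCell k m) :=
  (hw.locallyIntegrable.integrableOn_isCompact isCompact_Icc).mono_set Ico_subset_Icc_self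

theorem IsTestFunction.integral_eq (hw : IsTestFunction (dyadicCell k m) x₁ x₂ L w) :
    ∫ t in dyadicCell k m, w t = x₁ * 2 ^ k := by
  rw [← hw.average_eq, setAverage_dyadicCell]
  field_simp

theorem IsTestFunction.integral_sq_eq (hw : IsTestFunction (dyadicCell k m) x₁ x₂ L w) :
    ∫ t in dyadicCell k m, w t ^ 2 = x₂ * 2 ^ k := by
  rw [← hw.average_sq_eq, setAverage_dyadicCell]
  field_simp

theorem IsTestFunction.integral_truncatedMaximal_sq_le_of_le_half
    (hw : IsTestFunction (dyadicCell k m) x₁ x₂ L w) (hx : x₁ ≤ L / 2) (n : ℕ) :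
    ∫ t in dyadicCell k m, truncatedMaximal w n k L t ^ 2 ≤
      (4 * (x₂ - x₁ ^ 2) + L ^ 2) * 2 ^ k := by
  have key := integral_truncatedMaximal_sq_le n k m L hw.integrableOn
  have i1 := integrableOn_truncatedMaximal_sq w n k m L
  have i2 := integrableOn_mul_truncatedMaximal (w := w) n L hw.integrableOn
  have hwi := hw.integrableOn
  have hw2 := hw.sq_integrableOn
  -- The integrand is `(2(w - x₁) - (G - L))² + 2(G - L)(L - 2x₁)`, with `G` the truncated maximal
  -- function.
  have mono : 0 ≤ ∫ t in dyadicCell k m, ((-4) * (truncatedMaximal w n k L t * w t) +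
      1 * truncatedMaximal w n k L t ^ 2 + 4 * w t ^ 2 + 0 +
      (0 * w t + 0 * w t + (4 * L - 8 * x₁) * w t + (4 * x₁ ^ 2 - L ^ 2))) := by
    refine integral_nonneg fun t => ?_
    have hG := le_truncatedMaximal w n k L t
    simp only [Pi.zero_apply]
    nlinarith [sq_nonneg (2 * (w t - x₁) - (truncatedMaximal w n k L t - L)),
      mul_nonneg (sub_nonneg.2 hG) (sub_nonneg.2 hx)]
  rw [integral_add (integrableOn_linearCombination i2 i1 hw2 _ _ _ _)
    (integrableOn_linearCombination hwi hwi hwi _ _ _ _),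
    integral_linearCombination i2 i1 hw2, integral_linearCombination hwi hwi hwi,
    hw.integral_eq, hw.integral_sq_eq] at mono
  rw [hw.integral_eq] at key
  linarith

theorem IsTestFunction.integral_truncatedMaximal_sq_le
    (hw : IsTestFunction (dyadicCell k m) x₁ x₂ L w) (hx₁ : 0 < x₁) (hx₂ : x₁ ^ 2 ≤ x₂) (n : ℕ) :
    ∫ t in dyadicCell k m, truncatedMaximal w n k L t ^ 2 ≤
      (Real.sqrt x₂ + Real.sqrt (x₂ - L * (2 * x₁ - L))) ^ 2 * 2 ^ k := by
  have key := _root_.integral_truncatedMaximal_sq_le n k m L hw.integrableOn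
  have i1 := integrableOn_truncatedMaximal_sq w n k m L
  have i2 := integrableOn_mul_truncatedMaximal (w := w) n L hw.integrableOn
  have hw2 := hw.sq_integrableOn
  have hpos : (0 : ℝ) < 2 ^ k := by positivity
  set r := Real.sqrt x₂ with hr
  set p := Real.sqrt (x₂ - L * (2 * x₁ - L)) with hp
  have hx₂' : 0 < x₂ := by nlinarith
  have hr0 : 0 < r := Real.sqrt_pos.2 hx₂'
  have hr2 : r ^ 2 = x₂ := Real.sq_sqrt hx₂'.le
  have hp0 : 0 ≤ p := Real.sqrt_nonneg _
  have hp2 : p ^ 2 = x₂ - L * (2 * x₁ - L) := Real.sq_sqrt (by nlinarith [sq_nonneg (L - x₁)])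
  -- Minkowski's inequality in quadratic form. Since `p` may vanish and the last step divides by `r
  -- * v`, it is proved for `v > p` and then `v → p`.
  have hpert : ∀ v, p < v →
      ∫ t in dyadicCell k m, truncatedMaximal w n k L t ^ 2 ≤ (r + v) ^ 2 * 2 ^ k := by
    intro v hv
    have hv0 : 0 < v := hp0.trans_lt hv
    -- The integrand is `(v w - r (G - w))²`, which vanishes when `w` and `G - w` are proportional
    -- as in the equality case.
    have mono : 0 ≤ ∫ t in dyadicCell k m,
        (((r + v) * r - r * v) * truncatedMaximal w n k L t ^ 2 +
        (-(2 * ((r + v) * r))) * (truncatedMaximal w n k L t * w t) +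
        ((r + v) * v + (r + v) * r) * w t ^ 2 + 0) := by
      refine integral_nonneg fun t => ?_
      simp only [Pi.zero_apply]
      nlinarith [sq_nonneg (v * w t - r * (truncatedMaximal w n k L t - w t))]
    rw [integral_linearCombination i1 i2 hw2, hw.integral_sq_eq] at mono
    rw [hw.integral_eq] at key
    set X := ∫ t in dyadicCell k m, truncatedMaximal w n k L t ^ 2
    set Y := ∫ t in dyadicCell k m, truncatedMaximal w n k L t * w t
    have h1 : X - 2 * Y + x₂ * 2 ^ k ≤ v ^ 2 * 2 ^ k := by
      have : p ^ 2 * 2 ^ k ≤ v ^ 2 * 2 ^ k := by gcongr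
      rw [hp2] at this
      linarith
    have h2 := mul_le_mul_of_nonneg_left h1 (by positivity : 0 ≤ (r + v) * r)
    have h3 : (r * v) * X ≤ (r * v) * ((r + v) ^ 2 * 2 ^ k) := by
      rw [← hr2] at mono h2
      linarith
    exact le_of_mul_le_mul_left h3 (by positivity)
  have hc : ContinuousWithinAt (fun v : ℝ => (r + v) ^ 2 * 2 ^ k) (Ioi p) p := by
    fun_prop
  exact ge_of_tendsto hc (eventually_mem_nhdsWithin.mono hpert)

end UpperBound

theorem maximalBellman_le {k m : ℤ} {x₁ x₂ L V : ℝ} (hL : 0 ≤ L)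
    (hV : ∀ w, IsTestFunction (dyadicCell k m) x₁ x₂ L w → ∀ n,
      ∫ t in dyadicCell k m, truncatedMaximal w n k L t ^ 2 ≤ V * 2 ^ k) :
    maximalBellman (dyadicCell k m) x₁ x₂ L ≤ ENNReal.ofReal V :=
  iSup₂_le fun w hw => lintegral_dyadicMaximal_sq_le hL
    (fun I hI hJI => hw.isLUB_ancestors.1 ⟨I, hI, hJI, rfl⟩) (hV w hw)

/-! ### Attainable values and their mixtures -/

theorem dyadicMaximal_mono {v w : ℝ → ℝ} (hv : Integrable v) (hw : Integrable w)
    (h : ∀ t, v t ≤ w t) (t : ℝ) : dyadicMaximal v t ≤ dyadicMaximal w t := by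
  refine iSup₂_mono fun I _ => iSup_mono fun _ => ENNReal.ofReal_le_ofReal ?_
  rw [setAverage_eq, setAverage_eq]
  exact smul_le_smul_of_nonneg_left (integral_mono hv.integrableOn hw.integrableOn h)
    (inv_nonneg.2 measureReal_nonneg)

theorem ofReal_setAverage_le_dyadicMaximal (w : ℝ → ℝ) {I : Set ℝ} (hI : I ∈ dyadicIntervals)
    {t : ℝ} (ht : t ∈ I) : ENNReal.ofReal (⨍ s in I, w s) ≤ dyadicMaximal w t :=
  le_iSup₂_of_le I hI (le_iSup_of_le ht le_rfl)

/-- On the dyadic interval `[m 2^k, (m+1) 2^k)` there is a function with averages `x₁`, `x₂` of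
itself and its square, vanishing off the interval, for which the average of `(max L (M w))²` is at
least `y`. -/
def IsAttainableOn (k m : ℤ) (x₁ x₂ L y : ℝ) : Prop :=
  ∃ w : ℝ → ℝ, (∀ t, 0 ≤ w t) ∧ (∀ t, t ∉ dyadicCell k m → w t = 0) ∧ Integrable w ∧
    Integrable (fun t => w t ^ 2) ∧ ∫ t, w t = x₁ * 2 ^ k ∧ ∫ t, w t ^ 2 = x₂ * 2 ^ k ∧
    ENNReal.ofReal (y * 2 ^ k) ≤
      ∫⁻ t in dyadicCell k m, max (ENNReal.ofReal L) (dyadicMaximal w t) ^ 2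

/-- `IsAttainableOn` for all dyadic intervals. -/
def IsAttainable (x₁ x₂ L y : ℝ) : Prop := ∀ k m, IsAttainableOn k m x₁ x₂ L y

theorem IsAttainable.midpoint {a₁ a₂ b₁ b₂ L y z : ℝ} (ha : IsAttainable a₁ a₂ L y)
    (hb : IsAttainable b₁ b₂ L z) :
    IsAttainable ((a₁ + b₁) / 2) ((a₂ + b₂) / 2) L ((y + z) / 2) := by
  intro k m
  obtain ⟨u, u0, us, ui, ui2, uI, uI2, uM⟩ := ha (k - 1) (2 * m)
  obtain ⟨v, v0, vs, vi, vi2, vI, vI2, vM⟩ := hb (k - 1) (2 * m + 1)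
  have hd := disjoint_halves k m
  have huv : ∀ t, u t * v t = 0 := by
    intro t
    by_cases ht : t ∈ dyadicCell (k - 1) (2 * m)
    · rw [vs t (Set.disjoint_left.1 hd ht), mul_zero]
    · rw [us t ht, zero_mul]
  have hsq : (fun t => (u t + v t) ^ 2) = fun t => u t ^ 2 + v t ^ 2 := by
    funext t
    linear_combination 2 * huv t
  refine ⟨fun t => u t + v t, fun t => add_nonneg (u0 t) (v0 t), fun t ht => ?_, ui.add vi, ?_,
    ?_, ?_, ?_⟩
  · rw [dyadicCell_eq_union, mem_union, not_or] at ht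
    simp only [us t ht.1, vs t ht.2, add_zero]
  · rw [hsq]
    exact ui2.add vi2
  · rw [integral_add ui vi, uI, vI, two_zpow_eq k]
    ring
  · rw [hsq, integral_add ui2 vi2, uI2, vI2, two_zpow_eq k]
    ring
  · rw [dyadicCell_eq_union, lintegral_union (measurableSet_dyadicCell _ _) hd]
    have e : (y + z) / 2 * 2 ^ k = y * 2 ^ (k - 1) + z * 2 ^ (k - 1) := by
      rw [two_zpow_eq k]
      ring
    rw [e]
    refine ENNReal.ofReal_add_le.trans (add_le_add (uM.trans ?_) (vM.trans ?_))
    · refine lintegral_mono fun t => ?_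
      have := dyadicMaximal_mono ui (ui.add vi) (fun t => le_add_of_nonneg_right (v0 t)) t
      dsimp only
      gcongr
      exact this
    · refine lintegral_mono fun t => ?_
      have := dyadicMaximal_mono vi (ui.add vi) (fun t => le_add_of_nonneg_left (u0 t)) t
      dsimp only
      gcongr
      exact this

theorem IsAttainable.dyadic_mix {a₁ a₂ b₁ b₂ L y z : ℝ} (ha : IsAttainable a₁ a₂ L y)
    (hb : IsAttainable b₁ b₂ L z) (n N : ℕ) (hN : N ≤ 2 ^ n) {θ : ℝ}
    (hθ : θ = (N : ℝ) / 2 ^ n) :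
    IsAttainable (θ * a₁ + (1 - θ) * b₁) (θ * a₂ + (1 - θ) * b₂) L (θ * y + (1 - θ) * z) := by
  induction n generalizing N θ with
  | zero =>
    rw [pow_zero] at hN
    interval_cases N
    · simpa [hθ] using hb
    · simpa [hθ] using ha
  | succ n ih =>
    -- For `θ ≤ 1/2` one half carries only `b` and the other the mixture with ratio `2θ`; otherwise
    -- one half carries only `a` and the other has ratio `2θ - 1`.
    rcases le_total N (2 ^ n) with h | h
    · have := (ih N h rfl).midpoint hb
      rw [pow_succ] at hθ
      convert this using 1 <;> rw [hθ] <;> field_simp <;> ring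
    · have := ha.midpoint (ih (N - 2 ^ n) (by rw [pow_succ] at hN; omega) rfl)
      rw [Nat.cast_sub h] at this
      rw [pow_succ] at hθ
      push_cast at this
      convert this using 1 <;> rw [hθ] <;> field_simp <;> ring

theorem setIntegral_eq_of_support {w : ℝ → ℝ} {k m : ℤ}
    (hs : ∀ t, t ∉ dyadicCell k m → w t = 0) : ∫ t in dyadicCell k m, w t = ∫ t, w t :=
  setIntegral_eq_integral_of_forall_compl_eq_zero hs

theorem lintegral_const_dyadicCell {c : ℝ} (hc : 0 ≤ c) (k m : ℤ) :
    ∫⁻ _ in dyadicCell k m, ENNReal.ofReal c = ENNReal.ofReal (c * 2 ^ k) := by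
  rw [setLIntegral_const, volume_dyadicCell, ENNReal.ofReal_mul hc]

theorem isAttainable_const {c L : ℝ} (hc : 0 ≤ c) (hL : 0 ≤ L) :
    IsAttainable c (c ^ 2) L (L ^ 2) := by
  intro k m
  have hi : ∀ d : ℝ, Integrable ((dyadicCell k m).indicator fun _ => d) := fun d =>
    (integrableOn_const_dyadicCell d k m).integrable_indicator (measurableSet_dyadicCell k m)
  have hsq : (fun t => ((dyadicCell k m).indicator (fun _ => c) t) ^ 2) =
      (dyadicCell k m).indicator fun _ => c ^ 2 := by
    funext t
    by_cases ht : t ∈ dyadicCell k m <;> simp [ht]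
  refine ⟨(dyadicCell k m).indicator fun _ => c, fun t => indicator_nonneg (fun _ _ => hc) t,
    fun t ht => indicator_of_notMem ht _, hi c, ?_, ?_, ?_, ?_⟩
  · rw [hsq]
    exact hi _
  · rw [integral_indicator (measurableSet_dyadicCell k m), setIntegral_const_dyadicCell]
  · rw [hsq, integral_indicator (measurableSet_dyadicCell k m), setIntegral_const_dyadicCell]
  · rw [← lintegral_const_dyadicCell (sq_nonneg L)]
    refine lintegral_mono fun t => ?_
    dsimp only
    rw [ENNReal.ofReal_pow hL]
    gcongr
    exact le_max_left _ _

/-- Seed of the iteration: only the two moments matter, so a multiple of an indicator suffices. -/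
theorem isAttainable_zero {l q L : ℝ} (hl : 0 ≤ l) (hq : 1 ≤ q) :
    IsAttainable l (l ^ 2 * q) L 0 := by
  intro k m
  have hp : (0 : ℝ) < 2 ^ k := by positivity
  have hq0 : 0 < q := by linarith
  set s : ℝ := (m : ℝ) * 2 ^ k with hs
  set S : Set ℝ := Ico s (s + 2 ^ k / q) with hS
  have hSm : MeasurableSet S := measurableSet_Ico
  have hSv : volume.real S = 2 ^ k / q := by
    rw [hS, Real.volume_real_Ico_of_le (by linarith [div_pos hp hq0])]
    ring
  have hsub : S ⊆ dyadicCell k m := by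
    refine Ico_subset_Ico_right ?_
    have : (2 : ℝ) ^ k / q ≤ 2 ^ k := div_le_self hp.le hq
    linarith
  have hi : ∀ d : ℝ, Integrable (S.indicator fun _ => d) := fun d =>
    ((integrableOn_const_dyadicCell d k m).mono_set hsub).integrable_indicator hSm
  have hsq : (fun t => (S.indicator (fun _ => l * q) t) ^ 2) =
      S.indicator fun _ => (l * q) ^ 2 := by
    funext t
    by_cases ht : t ∈ S <;> simp [ht]
  refine ⟨S.indicator fun _ => l * q, fun t => indicator_nonneg (fun _ _ => by positivity) t,
    fun t ht => indicator_of_notMem (fun h => ht (hsub h)) _, hi _, ?_, ?_, ?_, by simp⟩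
  · rw [hsq]
    exact hi _
  · rw [integral_indicator hSm, setIntegral_const, hSv, smul_eq_mul]
    field_simp
  · rw [hsq, integral_indicator hSm, setIntegral_const, hSv, smul_eq_mul]
    field_simp

/-- The interval's own average is among those in the maximal function, so a floor not exceeding `x₁`
costs nothing. -/
theorem IsAttainable.of_le_max {x₁ x₂ L L' y : ℝ} (h : IsAttainable x₁ x₂ L y)
    (hL : L ≤ max x₁ L') : IsAttainable x₁ x₂ L' y := by
  intro k m
  obtain ⟨w, w0, ws, wi, wi2, wI, wI2, wM⟩ := h k m
  refine ⟨w, w0, ws, wi, wi2, wI, wI2,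
    wM.trans (setLIntegral_mono' (measurableSet_dyadicCell k m) fun t ht => ?_)⟩
  gcongr ?_ ^ 2
  refine max_le ?_ (le_max_right _ _)
  rcases le_max_iff.1 hL with h | h
  · refine le_max_of_le_right (le_trans (ENNReal.ofReal_le_ofReal (h.trans (le_of_eq ?_)))
      (ofReal_setAverage_le_dyadicMaximal w (dyadicCell_mem k m) ht))
    rw [setAverage_dyadicCell, setIntegral_eq_of_support ws, wI]
    field_simp
  · exact le_max_of_le_left (ENNReal.ofReal_le_ofReal h)

theorem IsAttainable.anti {x₁ x₂ L y y' : ℝ} (h : IsAttainable x₁ x₂ L y) (hy : y' ≤ y) :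
    IsAttainable x₁ x₂ L y' := by
  intro k m
  obtain ⟨w, w0, ws, wi, wi2, wI, wI2, wM⟩ := h k m
  exact ⟨w, w0, ws, wi, wi2, wI, wI2, le_trans (ENNReal.ofReal_le_ofReal (by gcongr)) wM⟩

/-! ### Self-similar extremals on the line `x₁ = L` -/

/-- One step of the self-similar construction: on the proportion `1 - 2⁻ⁿ` of an interval put
copies of the function multiplied by `e`, and the constant `c` on the rest. -/
theorem isAttainable_selfSimilar_step {q y c e : ℝ} {n : ℕ} (hc : 0 ≤ c) (he : 1 ≤ e)
    (h1 : (1 - 1 / 2 ^ n) * e + 1 / 2 ^ n * c = 1)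
    (h2 : (1 - 1 / 2 ^ n) * (e ^ 2 * q) + 1 / 2 ^ n * c ^ 2 = q)
    (h : ∀ l, 0 < l → IsAttainable l (l ^ 2 * q) l (l ^ 2 * y)) :
    ∀ l, 0 < l → IsAttainable l (l ^ 2 * q) l
      (l ^ 2 * ((1 - 1 / 2 ^ n) * e ^ 2 * y + 1 / 2 ^ n)) := by
  intro l hl
  have hA := (h (l * e) (by positivity)).of_le_max (L' := l) (le_max_left _ _)
  have hC := isAttainable_const (c := l * c) (L := l) (by positivity) hl.le
  have hN : 1 ≤ 2 ^ n := Nat.one_le_two_pow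
  have := hA.dyadic_mix hC n (2 ^ n - 1) (Nat.sub_le _ _) (θ := 1 - 1 / 2 ^ n) (by
    rw [Nat.cast_sub hN]
    push_cast
    field_simp)
  convert this using 1
  · linear_combination (-l) * h1
  · linear_combination (-l ^ 2) * h2
  · ring

theorem isAttainable_selfSimilar {q u : ℝ} {n : ℕ} (hq : 1 ≤ q) (hn : n ≠ 0)
    (hu : u = 1 + Real.sqrt ((1 - 1 / 2 ^ n) * (1 - 1 / q))) {y : ℝ} (hy : y < q * u ^ 2)
    {l : ℝ} (hl : 0 < l) : IsAttainable l (l ^ 2 * q) l (l ^ 2 * y) := by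
  have hq0 : 0 < q := by linarith
  set δ : ℝ := 1 / 2 ^ n with hδ
  have hδ0 : 0 < δ := by positivity
  have hδ1 : δ < 1 := by
    rw [hδ, div_lt_one (by positivity)]
    exact one_lt_pow₀ (by norm_num) hn
  have hδ1' : 0 < 1 - δ := by linarith
  have hrad : 0 ≤ (1 - δ) * (1 - 1 / q) :=
    mul_nonneg hδ1'.le (sub_nonneg.2 ((div_le_one hq0).2 hq))
  have hu1 : 1 ≤ u := by rw [hu]; linarith [Real.sqrt_nonneg ((1 - δ) * (1 - 1 / q))]
  have hu0 : 0 < u := by linarith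
  have hquad : q * (u - 1) ^ 2 = (1 - δ) * (q - 1) := by
    rw [hu, add_sub_cancel_left, Real.sq_sqrt hrad]
    field_simp
  -- On the constant piece the function is `l * c` and the floor is `l`, so their ratio is `u`. The
  -- average fixes `e`, and `hquad` is the condition on `u` that makes the second moment reproduce
  -- itself.
  set c : ℝ := 1 / u with hc
  have hcu : c * u = 1 := by rw [hc]; field_simp
  have hc0 : 0 < c := by positivity
  have hc1 : c ≤ 1 := by rw [hc, div_le_one hu0]; exact hu1
  set e : ℝ := (1 - δ * c) / (1 - δ) with he
  have hee : (1 - δ) * e = 1 - δ * c := by rw [he]; field_simp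
  have he1 : 1 ≤ e := by
    rw [he, one_le_div hδ1']
    nlinarith
  have h1 : (1 - δ) * e + δ * c = 1 := by linarith
  have h2 : (1 - δ) * (e ^ 2 * q) + δ * c ^ 2 = q := by
    refine mul_left_cancel₀ hδ1'.ne' ?_
    have : (1 - δ) * ((1 - δ) * (e ^ 2 * q) + δ * c ^ 2) =
        q * ((1 - δ) * e) ^ 2 + (1 - δ) * δ * c ^ 2 := by ring
    rw [this, hee]
    have hq' : q * (1 - c) ^ 2 = (1 - δ) * (q - 1) * c ^ 2 := by
      have : (1 - c) = (u - 1) * c := by linarith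
      rw [this, mul_pow, ← mul_assoc, hquad]
    linear_combination δ * hq'
  set ρ : ℝ := (1 - δ) * e ^ 2 with hρ
  have hρ0 : 0 ≤ ρ := by positivity
  have hρq : ρ * q = q - δ * c ^ 2 := by rw [hρ]; linarith
  have hρ1 : ρ < 1 := by
    have : 0 < δ * c ^ 2 := by positivity
    by_contra hcon
    nlinarith [not_lt.1 hcon]
  -- `q u²` is the fixed point of the contraction `y ↦ ρ y + δ` given by one step.
  have hfix : ρ * (q * u ^ 2) + δ = q * u ^ 2 := by
    linear_combination u ^ 2 * hρq - δ * (c * u + 1) * hcu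
  have hiter : ∀ N : ℕ, ∀ l, 0 < l →
      IsAttainable l (l ^ 2 * q) l (l ^ 2 * (q * u ^ 2 * (1 - ρ ^ N))) := by
    intro N
    induction N with
    | zero =>
      intro l hl
      simpa using isAttainable_zero hl.le hq
    | succ N ih =>
      intro l hl
      have := isAttainable_selfSimilar_step hc0.le he1 h1 h2 ih l hl
      convert this using 2
      rw [← hδ, ← hρ, pow_succ]
      linear_combination -hfix
  have hlim : Filter.Tendsto (fun N : ℕ => q * u ^ 2 * (1 - ρ ^ N)) Filter.atTop
      (nhds (q * u ^ 2 * (1 - 0))) :=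
    ((tendsto_pow_atTop_nhds_zero_of_lt_one hρ0 hρ1).const_sub 1).const_mul _
  rw [sub_zero, mul_one] at hlim
  obtain ⟨N, hN⟩ := (hlim.eventually_const_lt hy).exists
  exact (hiter N l hl).anti (by gcongr)

theorem isAttainable_of_average_eq_max {z l y : ℝ} (hl : 0 < l) (hz : l ^ 2 ≤ z)
    (hy : y < (Real.sqrt z + Real.sqrt (z - l ^ 2)) ^ 2) : IsAttainable l z l y := by
  have hl2 : 0 < l ^ 2 := by positivity
  have hz0 : 0 < z := hl2.trans_le hz
  set q := z / l ^ 2 with hq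
  have hq1 : 1 ≤ q := (one_le_div hl2).2 hz
  have hzq : z = l ^ 2 * q := by rw [hq]; field_simp
  have hlim : Filter.Tendsto
      (fun n : ℕ => q * (1 + Real.sqrt ((1 - 1 / 2 ^ n) * (1 - 1 / q))) ^ 2) Filter.atTop
      (nhds (q * (1 + Real.sqrt ((1 - 0) * (1 - 1 / q))) ^ 2)) := by
    have h : Filter.Tendsto (fun n : ℕ => (1 : ℝ) / 2 ^ n) Filter.atTop (nhds 0) := by
      simpa using tendsto_pow_atTop_nhds_zero_of_lt_one (r := (1 / 2 : ℝ)) (by norm_num)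
        (by norm_num)
    exact ((((h.const_sub 1).mul_const _).sqrt.const_add 1).pow 2).const_mul q
  have hval : q * (1 + Real.sqrt ((1 - 0) * (1 - 1 / q))) ^ 2 =
      (Real.sqrt z + Real.sqrt (z - l ^ 2)) ^ 2 / l ^ 2 := by
    have : z - l ^ 2 = z * (1 - 1 / q) := by
      rw [hq]
      field_simp
    rw [sub_zero, one_mul, this, Real.sqrt_mul hz0.le, ← mul_one_add, mul_pow,
      Real.sq_sqrt hz0.le, hq]
    ring
  rw [hval] at hlim
  have hy' : y / l ^ 2 < (Real.sqrt z + Real.sqrt (z - l ^ 2)) ^ 2 / l ^ 2 := by gcongr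
  obtain ⟨n, hn, hn0⟩ := ((hlim.eventually_const_lt hy').and
    (Filter.eventually_ne_atTop 0)).exists
  have := isAttainable_selfSimilar hq1 hn0 rfl hn hl
  rwa [← hzq, mul_div_cancel₀ _ hl2.ne'] at this

/-! ### Mixing with a constant when `x₁ < L` -/

theorem isAttainable_of_dyadic_ratio {x₁ x₂ L y α : ℝ} {n N : ℕ} (hL : 0 < L)
    (hα : α = (N : ℝ) / 2 ^ n) (hα0 : 0 < α) (hα1 : α < 1) (hx₁ : 0 ≤ x₁ - α * L)
    (hR : α * L ^ 2 ≤ x₂ - (x₁ - α * L) ^ 2 / (1 - α))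
    (hy : y < (1 - α) * L ^ 2 + (Real.sqrt (x₂ - (x₁ - α * L) ^ 2 / (1 - α)) +
      Real.sqrt (x₂ - (x₁ - α * L) ^ 2 / (1 - α) - α * L ^ 2)) ^ 2) :
    IsAttainable x₁ x₂ L y := by
  have hα1' : 0 < 1 - α := by linarith
  -- `R` is the share of the second moment left to the proportion `α`, after the constant `c` on the
  -- rest.
  set R := x₂ - (x₁ - α * L) ^ 2 / (1 - α) with hRdef
  set c := (x₁ - α * L) / (1 - α) with hc
  have hN : N ≤ 2 ^ n := by
    rw [hα, div_lt_one (by positivity)] at hα1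
    exact_mod_cast hα1.le
  have hA : IsAttainable L (R / α) L ((y - (1 - α) * L ^ 2) / α) := by
    refine isAttainable_of_average_eq_max hL ((le_div_iff₀ hα0).2 (by linarith)) ?_
    have : R / α - L ^ 2 = (R - α * L ^ 2) / α := by field_simp
    rw [this, Real.sqrt_div' _ hα0.le, Real.sqrt_div' _ hα0.le, ← add_div, div_pow,
      Real.sq_sqrt hα0.le]
    gcongr
    linarith
  have hC := isAttainable_const (c := c) (L := L) (div_nonneg hx₁ hα1'.le) hL.le
  have := hA.dyadic_mix hC n N hN hα
  convert this using 1
  · rw [hc]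
    field_simp
    ring
  · rw [hc, mul_div_cancel₀ _ hα0.ne', hRdef]
    field_simp
    ring
  · field_simp
    ring

theorem frequently_dyadic_nhdsGT {a : ℝ} (ha : 0 ≤ a) :
    ∃ᶠ α in nhdsWithin a (Ioi a), ∃ n N : ℕ, α = (N : ℝ) / 2 ^ n := by
  have hlim : Filter.Tendsto (fun n : ℕ => ((⌊a * 2 ^ n⌋₊ + 1 : ℕ) : ℝ) / 2 ^ n) Filter.atTop
      (nhdsWithin a (Ioi a)) := by
    refine tendsto_nhdsWithin_iff.2 ⟨?_, Filter.Eventually.of_forall fun n => ?_⟩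
    · refine tendsto_of_tendsto_of_tendsto_of_le_of_le tendsto_const_nhds
        (h := fun n : ℕ => a + (1 / 2 : ℝ) ^ n) ?_ (fun n => ?_) (fun n => ?_)
      · simpa using (tendsto_pow_atTop_nhds_zero_of_lt_one (r := (1 / 2 : ℝ)) (by norm_num)
          (by norm_num)).const_add a
      · rw [le_div_iff₀ (by positivity)]
        push_cast
        exact (Nat.lt_floor_add_one _).le
      · dsimp only
        rw [div_le_iff₀ (by positivity), add_mul, ← mul_pow]
        push_cast
        have := Nat.floor_le (show 0 ≤ a * 2 ^ n by positivity)
        norm_num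
        exact this
    · rw [mem_Ioi, lt_div_iff₀ (by positivity)]
      push_cast
      exact Nat.lt_floor_add_one _
  exact hlim.frequently (Filter.Frequently.of_forall fun n => ⟨n, _, rfl⟩)

/-- By continuity a dyadic ratio slightly above `α` works; approaching from the right keeps it
positive, so `α = 0` is allowed. -/
theorem isAttainable_of_ratio {x₁ x₂ L y α : ℝ} (hL : 0 < L) (hα0 : 0 ≤ α) (hα1 : α < 1)
    (hx₁ : 0 < x₁ - α * L) (hR : α * L ^ 2 < x₂ - (x₁ - α * L) ^ 2 / (1 - α))
    (hy : y < (1 - α) * L ^ 2 + (Real.sqrt (x₂ - (x₁ - α * L) ^ 2 / (1 - α)) +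
      Real.sqrt (x₂ - (x₁ - α * L) ^ 2 / (1 - α) - α * L ^ 2)) ^ 2) :
    IsAttainable x₁ x₂ L y := by
  have hne : 1 - α ≠ 0 := by linarith
  have c1 : ContinuousAt (fun a : ℝ => x₁ - a * L) α := by fun_prop
  have c2 : ContinuousAt (fun a : ℝ => x₂ - (x₁ - a * L) ^ 2 / (1 - a)) α := by
    fun_prop (disch := assumption)
  have c3 : ContinuousAt (fun a : ℝ => a * L ^ 2) α := by fun_prop
  have c4 : ContinuousAt (fun a : ℝ => (1 - a) * L ^ 2 +
      (Real.sqrt (x₂ - (x₁ - a * L) ^ 2 / (1 - a)) +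
      Real.sqrt (x₂ - (x₁ - a * L) ^ 2 / (1 - a) - a * L ^ 2)) ^ 2) α := by
    fun_prop (disch := assumption)
  have e1 := c1.eventually_const_lt hx₁
  have e2 := c3.eventually_lt c2 hR
  have e3 := c4.eventually_const_lt hy
  have e4 := (continuousAt_id (x := α)).eventually_lt_const hα1
  have ev := (((e1.and e2).and (e3.and e4)).filter_mono
    (nhdsWithin_le_nhds (s := Ioi α))).and self_mem_nhdsWithin
  obtain ⟨a, ⟨n, N, ha⟩, ⟨⟨h1, h2⟩, h3, h4⟩, h5⟩ :=
    ((frequently_dyadic_nhdsGT hα0).and_eventually ev).exists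
  exact isAttainable_of_dyadic_ratio hL ha (hα0.trans_lt h5) h4 h1.le h2.le h3

theorem isAttainable_of_le_half {x₁ x₂ L y : ℝ} (hL : 0 < L) (hx₁ : 0 < x₁)
    (hx₂ : x₁ ^ 2 ≤ x₂) (hy : y < 4 * (x₂ - x₁ ^ 2) + L ^ 2) : IsAttainable x₁ x₂ L y := by
  rcases hx₂.eq_or_lt with rfl | hx₂
  · exact (isAttainable_const hx₁.le hL.le).anti (by linarith)
  · refine isAttainable_of_ratio (α := 0) hL le_rfl one_pos (by linarith) (by simpa using hx₂) ?_
    simp only [zero_mul, sub_zero, one_mul, div_one]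
    have := Real.sq_sqrt (sub_nonneg.2 hx₂.le)
    nlinarith

theorem isAttainable_of_half_le {x₁ x₂ L y : ℝ} (hx₁ : 0 < x₁) (hxL : x₁ ≤ L)
    (hLx : L / 2 ≤ x₁) (hx₂ : x₁ ^ 2 ≤ x₂)
    (hy : y < (Real.sqrt x₂ + Real.sqrt (x₂ - L * (2 * x₁ - L))) ^ 2) :
    IsAttainable x₁ x₂ L y := by
  have hL : 0 < L := hx₁.trans_le hxL
  rcases hxL.eq_or_lt with rfl | hxL
  · refine isAttainable_of_average_eq_max hL hx₂ ?_
    rwa [show x₂ - x₁ * (2 * x₁ - x₁) = x₂ - x₁ ^ 2 by ring] at hy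
  have hx₂0 : 0 < x₂ := by nlinarith
  rcases hx₂.eq_or_lt with rfl | hx₂
  · refine (isAttainable_const hx₁.le hL.le).anti (hy.le.trans (le_of_eq ?_))
    rw [show x₁ ^ 2 - L * (2 * x₁ - L) = (L - x₁) ^ 2 by ring, Real.sqrt_sq hx₁.le,
      Real.sqrt_sq (by linarith)]
    ring
  set r := Real.sqrt x₂ with hr
  set p := Real.sqrt (x₂ - L * (2 * x₁ - L)) with hp
  have hr2 : r ^ 2 = x₂ := Real.sq_sqrt hx₂0.le
  have hp2 : p ^ 2 = x₂ - L * (2 * x₁ - L) := Real.sq_sqrt (by nlinarith [sq_nonneg (L - x₁)])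
  have hrx : x₁ < r := Real.lt_sqrt_of_sq_lt hx₂
  have hpx : L - x₁ < p := Real.lt_sqrt_of_sq_lt (by nlinarith)
  have hp0 : 0 < p := by linarith
  have hr0 : 0 < r := by linarith
  -- `T` is the fraction of the second moment carried by the proportion `α`, as `hR` shows.
  set T := 1 - (L - x₁) * L / (p * (r + p)) with hT
  have hT0 : 0 < T := by
    rw [hT, sub_pos, div_lt_one (by positivity)]
    nlinarith
  -- On the constant piece `G = L` and `w = c`; equality in Minkowski, `p c = r (L - c)`, forces `c
  -- = L r / (r + p)`, and `α L + (1 - α) c = x₁` then gives `α`.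
  set α := 1 - (L - x₁) * (r + p) / (L * p) with hα
  have hα1 : 1 - α = (L - x₁) * (r + p) / (L * p) := by rw [hα]; ring
  have hd : r ^ 2 - p ^ 2 = L * (2 * x₁ - L) := by rw [hr2, hp2]; ring
  have hαL : α * L ^ 2 = (r ^ 2 - p ^ 2) * T := by
    rw [hα, hT]
    field_simp
    linear_combination (-(p * (r + p))) * hd
  have hxα : x₁ - α * L = (1 - α) * (L * r / (r + p)) := by
    rw [hα1, hα]
    field_simp
    ring
  have hα1' : 0 < 1 - α := by
    rw [hα1]
    have : 0 < L - x₁ := by linarith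
    positivity
  have hR : x₂ - (x₁ - α * L) ^ 2 / (1 - α) = r ^ 2 * T := by
    have : (x₁ - α * L) ^ 2 / (1 - α) = (1 - α) * (L * r / (r + p)) ^ 2 := by
      rw [hxα]
      field_simp
    rw [this, hα1, hT, ← hr2]
    field_simp
  have hR' : r ^ 2 * T - α * L ^ 2 = p ^ 2 * T := by rw [hαL]; ring
  have hα0 : 0 ≤ α := by
    have : 0 ≤ α * L ^ 2 := by
      rw [hαL, hd]
      have : 0 ≤ 2 * x₁ - L := by linarith
      positivity
    exact nonneg_of_mul_nonneg_left this (by positivity)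
  refine isAttainable_of_ratio (α := α) hL hα0 (by linarith) ?_ ?_ ?_
  · rw [hxα]
    positivity
  · have : 0 < p ^ 2 * T := by positivity
    rw [hR]
    linarith
  · rw [hR, hR', Real.sqrt_mul (sq_nonneg _), Real.sqrt_mul (sq_nonneg _), Real.sqrt_sq hr0.le,
      Real.sqrt_sq hp0.le, ← add_mul, mul_pow, Real.sq_sqrt hT0.le]
    refine hy.trans_le (le_of_eq ?_)
    rw [hα1, hT]
    field_simp
    ring

/-! ### Realizing `L` by the ancestors, and conclusion -/

theorem IsAttainableOn.exists_isTestFunction {k m : ℤ} {x₁ x₂ L y : ℝ}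
    (h : IsAttainableOn k m x₁ x₂ L y) (hx₁ : 0 < x₁) (hxL : x₁ ≤ L) :
    ∃ w, IsTestFunction (dyadicCell k m) x₁ x₂ L w ∧
      ENNReal.ofReal (y * 2 ^ k) ≤ ∫⁻ t in dyadicCell k m, dyadicMaximal w t ^ 2 := by
  obtain ⟨w, w0, ws, wi, wi2, wI, wI2, wM⟩ := h
  have hpos : (0 : ℝ) < 2 ^ k := by positivity
  obtain ⟨M, m', hPM, hdisj⟩ : ∃ M m' : ℤ,
      dyadicCell (k + 1) M = dyadicCell k m ∪ dyadicCell k m' ∧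
      Disjoint (dyadicCell k m) (dyadicCell k m') := by
    rcases Int.even_or_odd' m with ⟨M, hM | hM⟩
    · refine ⟨M, m + 1, ?_, disjoint_dyadicCell (by omega)⟩
      rw [dyadicCell_eq_union, add_sub_cancel_right, hM]
    · refine ⟨M, m - 1, ?_, disjoint_dyadicCell (by omega)⟩
      rw [dyadicCell_eq_union, add_sub_cancel_right, hM, add_sub_cancel_right, union_comm]
  -- The value `2L - x₁` on the sibling gives the parent average `L`; with no other mass, larger
  -- ancestors average at most `L`.
  set b : ℝ → ℝ := (dyadicCell k m').indicator fun _ => 2 * L - x₁ with hb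
  have hb0 : ∀ t, 0 ≤ b t := fun t => indicator_nonneg (fun _ _ => by linarith) t
  have hbi : Integrable b :=
    (integrableOn_const_dyadicCell _ k m').integrable_indicator (measurableSet_dyadicCell k m')
  have hbI : ∫ t, b t = (2 * L - x₁) * 2 ^ k := by
    rw [hb, integral_indicator (measurableSet_dyadicCell k m'), setIntegral_const_dyadicCell]
  have hvi : Integrable fun t => w t + b t := wi.add hbi
  have hv0 : ∀ t, 0 ≤ w t + b t := fun t => add_nonneg (w0 t) (hb0 t)
  have hvI : ∫ t, (w t + b t) = 2 * L * 2 ^ k := by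
    rw [integral_add wi hbi, wI, hbI]
    ring
  have hJ : ∀ t ∈ dyadicCell k m, b t = 0 := fun t ht =>
    indicator_of_notMem (Set.disjoint_left.1 hdisj ht) _
  have hvJ : ∫ t in dyadicCell k m, (w t + b t) = x₁ * 2 ^ k := by
    rw [setIntegral_congr_fun (measurableSet_dyadicCell k m)
      (fun t ht => by simp only [hJ t ht, add_zero] : EqOn (fun t => w t + b t) w _),
      setIntegral_eq_of_support ws, wI]
  have hsqJ : EqOn (fun t => (w t + b t) ^ 2) (fun t => w t ^ 2) (dyadicCell k m) :=
    fun t ht => by simp only [hJ t ht, add_zero]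
  have hparent : ⨍ t in dyadicCell (k + 1) M, (w t + b t) = L := by
    rw [setAverage_dyadicCell, setIntegral_eq_of_support, hvI, two_zpow_eq (k + 1),
      add_sub_cancel_right]
    · field_simp
    · intro t ht
      rw [hPM, mem_union, not_or] at ht
      rw [ws t ht.1, hb, indicator_of_notMem ht.2, add_zero]
  have hle : ∀ I ∈ dyadicIntervals, dyadicCell k m ⊆ I → ⨍ t in I, (w t + b t) ≤ L := by
    rintro I ⟨j, p, rfl⟩ hsub
    change dyadicCell k m ⊆ dyadicCell j p at hsub
    change ⨍ t in dyadicCell j p, (w t + b t) ≤ L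
    have hkj : (2 : ℝ) ^ k ≤ 2 ^ j := by
      rw [← measureReal_dyadicCell k m, ← measureReal_dyadicCell j p]
      exact measureReal_mono hsub (volume_dyadicCell_ne_top j p)
    have hkj' : k ≤ j := (zpow_le_zpow_iff_right₀ (by norm_num)).1 hkj
    rw [setAverage_dyadicCell, div_le_iff₀ (by positivity)]
    rcases hkj'.eq_or_lt with rfl | hlt
    · have : m = p := by
        by_contra hne
        have hmem : (m : ℝ) * 2 ^ k ∈ dyadicCell k m := ⟨le_rfl, by nlinarith⟩
        exact Set.disjoint_left.1 (disjoint_dyadicCell hne) hmem (hsub hmem)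
      subst this
      rw [hvJ]
      gcongr
    · have h2 : (2 : ℝ) ^ (k + 1) ≤ 2 ^ j := zpow_le_zpow_right₀ (by norm_num) hlt
      rw [two_zpow_eq (k + 1), add_sub_cancel_right] at h2
      calc ∫ t in dyadicCell j p, (w t + b t) ≤ ∫ t, (w t + b t) :=
            setIntegral_le_integral hvi (Filter.Eventually.of_forall hv0)
        _ = L * (2 * 2 ^ k) := by rw [hvI]; ring
        _ ≤ L * 2 ^ j := by
            have : 0 ≤ L := by linarith
            gcongr
  have hmemP : dyadicCell k m ⊆ dyadicCell (k + 1) M := hPM ▸ subset_union_left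
  refine ⟨fun t => w t + b t, ⟨hv0, hvi.locallyIntegrable, ?_, ?_, ?_, ?_⟩, wM.trans ?_⟩
  · rw [setAverage_dyadicCell, hvJ]
    field_simp
  · exact (integrableOn_congr_fun hsqJ (measurableSet_dyadicCell k m)).2 wi2.integrableOn
  · rw [setAverage_dyadicCell, setIntegral_congr_fun (measurableSet_dyadicCell k m) hsqJ,
      setIntegral_eq_of_support (fun t ht => by rw [ws t ht]; ring), wI2]
    field_simp
  · refine ⟨?_, fun c hc => ?_⟩
    · rintro a ⟨I, hI, hsub, rfl⟩
      exact hle I hI hsub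
    · exact hc ⟨_, dyadicCell_mem (k + 1) M, hmemP, hparent.symm⟩
  · refine setLIntegral_mono' (measurableSet_dyadicCell k m) fun t ht => ?_
    gcongr ?_ ^ 2
    refine max_le ?_ (dyadicMaximal_mono wi hvi (fun t => le_add_of_nonneg_right (hb0 t)) t)
    have := ofReal_setAverage_le_dyadicMaximal (fun t => w t + b t)
      (dyadicCell_mem (k + 1) M) (hmemP ht)
    rwa [hparent] at this

theorem le_maximalBellman {k m : ℤ} {x₁ x₂ L V : ℝ} (hx₁ : 0 < x₁) (hxL : x₁ ≤ L)
    (hV : ∀ y < V, IsAttainable x₁ x₂ L y) :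
    ENNReal.ofReal V ≤ maximalBellman (dyadicCell k m) x₁ x₂ L := by
  have hpos : (0 : ℝ) < 2 ^ k := by positivity
  have hy : ∀ y < V, ENNReal.ofReal y ≤ maximalBellman (dyadicCell k m) x₁ x₂ L := by
    intro y hy
    obtain ⟨w, hw, hle⟩ := (hV y hy k m).exists_isTestFunction hx₁ hxL
    refine le_iSup₂_of_le w hw ?_
    rw [ENNReal.le_div_iff_mul_le (Or.inl (volume_dyadicCell_ne_zero k m))
      (Or.inl (volume_dyadicCell_ne_top k m)), volume_dyadicCell, ← ENNReal.ofReal_mul' hpos.le]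
    exact hle
  have hc : Filter.Tendsto ENNReal.ofReal (nhdsWithin V (Iio V)) (nhds (ENNReal.ofReal V)) :=
    ENNReal.continuous_ofReal.continuousWithinAt
  exact le_of_tendsto hc (eventually_mem_nhdsWithin.mono hy)

theorem mainTheorem3 (J : Set ℝ) (hJ : J ∈ dyadicIntervals) (x₁ x₂ L : ℝ)
    (hx₁ : 0 < x₁) (hx₁L : x₁ ≤ L) (hx₂ : x₁ ^ 2 ≤ x₂) :
    (x₁ ≤ L / 2 →
      maximalBellman J x₁ x₂ L = ENNReal.ofReal (4 * (x₂ - x₁ ^ 2) + L ^ 2)) ∧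
    (L / 2 ≤ x₁ →
      maximalBellman J x₁ x₂ L =
        ENNReal.ofReal ((Real.sqrt x₂ + Real.sqrt (x₂ - L * (2 * x₁ - L))) ^ 2)) := by
  obtain ⟨k, m, rfl⟩ := hJ
  have hL : 0 < L := hx₁.trans_le hx₁L
  refine ⟨fun h => le_antisymm ?_ ?_, fun h => le_antisymm ?_ ?_⟩
  · exact maximalBellman_le hL.le fun w hw => hw.integral_truncatedMaximal_sq_le_of_le_half h
  · exact le_maximalBellman hx₁ hx₁L fun y hy => isAttainable_of_le_half hL hx₁ hx₂ hy
  · exact maximalBellman_le hL.le fun w hw => hw.integral_truncatedMaximal_sq_le hx₁ hx₂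
  · exact le_maximalBellman hx₁ hx₁L fun y hy => isAttainable_of_half_le hx₁ hx₁L h hx₂ hy
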